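/- Let $\mathbf K$ be a field of characteristic zero and let $\mathrm{NSym}=\mathbf K\langle H_1,H_2,\dots\rangle$ be the free associative algebra of noncommutative symmetric functions, with $H_0=1$, $H_a=0$ for $a<0$, and $H_\alpha=H_{\alpha_1}\cdots H_{\alpha_k}$. Let $\mathrm{QSym}$ be the algebra of quasisymmetric functions over $\mathbf K$, with monomial basis $(M_\alpha)$ and fundamental functions $F_\alpha=\sum_\beta M_\beta$, the sum over all compositions $\beta$ refining $\alpha$, and pair $\mathrm{NSym}$ with $\mathrm{QSym}$ by $\langle H_\alpha,M_\beta\rangle=\delta_{\alpha\beta}$. For $F\in\mathrm{QSym}$ let $F^\perp$ be the linear operator on $\mathrm{NSym}$ with $\langle F^\perp X,G\rangle=\langle X,FG\rangle$ for all $G\in\mathrm{QSym}$. For $a\in\mathbb Z$ put $\mathbb B_a=\sum_{i\ge0}(-1)^iH_{a+i}F_{1^i}^\perp$, and for an integer sequence $\mu=(\mu_1,\dots,\mu_k)$ let $\mathfrak S_\mu=\mathbb B_{\mu_1}\cdots\mathbb B_{\mu_k}(1)$ be the immaculate function. For a composition $\alpha$ (all parts positive) let $R_\alpha=\sum_{\beta}(-1)^{\ell(\beta)-\ell(\alpha)}H_\beta$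 be the ribbon function, the sum over all compositions $\beta$ obtained from $\alpha$ by adding together parts in consecutive blocks, where $\ell$ is the number of parts; put $R_\beta=0$ if the integer sequence $\beta$ has a nonpositive part. Theorem (Campbell's rectangle theorem). For all integers $m\ge1$ and $k\ge0$, with $(m^k)=(m,\dots,m)$ the rectangle with $k$ rows of length $m$, $$\mathfrak S_{(m^k)}=\sum_{\sigma\in S_k}\epsilon(\sigma)\,R_{(m-1+\sigma_1,\;m-2+\sigma_2,\;\dots,\;m-k+\sigma_k)},$$ where $\epsilon(\sigma)$ is the sign of $\sigma$ and $\sigma_i=\sigma(i)$. -/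

import Mathlib

noncomputable section

namespace NCSym

open Finset

/-! ## Compositions

A composition is a finite list of positive integers, that is, a term of `List ℕ+`. -/

/-- `Coarser β α` is the refinement order `β ⪰ α`: the composition `β` is obtained from `α` by
cutting `α` into consecutive nonempty blocks and replacing every block by the sum of its parts. -/
def Coarser (β α : List ℕ+) : Prop :=
  ∃ blocks : List (List ℕ+), (∀ b ∈ blocks, b ≠ []) ∧ blocks.flatten = α ∧
    β.map (fun a : ℕ+ => (a : ℕ)) = blocks.map (fun b : List ℕ+ => (b.map (fun a : ℕ+ => (a : ℕ))).sum)

/-! ## Noncommutative symmetric functions -/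

/-- The algebra of noncommutative symmetric functions: the free associative unital algebra on
generators `H₁, H₂, …`. -/
abbrev NSym (K : Type*) [Field K] : Type _ := FreeAlgebra K ℕ+

/-- The complete homogeneous function `H_a` for `a : ℤ`, with `H_0 = 1` and `H_a = 0` for
`a < 0`. -/
def H (K : Type*) [Field K] (a : ℤ) : NSym K :=
  if h : 0 < a then FreeAlgebra.ι K (⟨a.toNat, by omega⟩ : ℕ+) else if a = 0 then 1 else 0

/-- `H_α = H_{α₁} H_{α₂} ⋯ H_{α_k}` for a composition `α`. -/
def Hcomp (K : Type*) [Field K] (α : List ℕ+) : NSym K :=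
  (α.map (fun a : ℕ+ => H K ((a : ℕ) : ℤ))).prod

/-- The ribbon function `R_α = ∑_{β ⪰ α} (-1)^{ℓ(β) - ℓ(α)} H_β` of a composition `α`
(here `ℓ(β) ≤ ℓ(α)`, and the sum is finite). -/
def ribbonComp (K : Type*) [Field K] (α : List ℕ+) : NSym K :=
  ∑ᶠ β ∈ {β : List ℕ+ | Coarser β α}, (-1 : K) ^ (α.length - β.length) • Hcomp K β

open Classical in
/-- The ribbon function indexed by an integer sequence: `R_μ` is the ribbon function if all parts
of `μ` are positive, and vanishes if `μ` has a nonpositive part. -/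
def ribbon (K : Type*) [Field K] (μ : List ℤ) : NSym K :=
  if h : ∀ a ∈ μ, 0 < a then
    ribbonComp K (μ.pmap (fun (a : ℤ) (ha : 0 < a) => (⟨a.toNat, by omega⟩ : ℕ+)) h)
  else 0

/-! ## Quasisymmetric functions

These are power series in the commuting variables `x_0, x_1, x_2, …`. -/

/-- The exponent vector of the monomial `x_{j 0}^{α_1} x_{j 1}^{α_2} ⋯`. -/
def expo (α : List ℕ+) (j : Fin α.length → ℕ) : ℕ →₀ ℕ :=
  ∑ i, Finsupp.single (j i) ((α.get i : ℕ+) : ℕ)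

/-- The exponent vector of the monomial `x^α`, which uses an initial segment of the variables. -/
def expo₀ (α : List ℕ+) : ℕ →₀ ℕ := expo α (fun i => (i : ℕ))

/-- A power series is quasisymmetric if it has bounded degree and if, for each composition `α`, the
coefficients of all monomials `x_{j 0}^{α_1} x_{j 1}^{α_2} ⋯` with `j 0 < j 1 < ⋯` are equal. -/
def IsQuasisymmetric {K : Type*} [Field K] (f : MvPowerSeries ℕ K) : Prop :=
  (∃ N : ℕ, ∀ d : ℕ →₀ ℕ, MvPowerSeries.coeff d f ≠ 0 → d.degree ≤ N) ∧
  ∀ (α : List ℕ+) (j : Fin α.length → ℕ), StrictMono j →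
    MvPowerSeries.coeff (expo α j) f = MvPowerSeries.coeff (expo₀ α) f

open Classical in
/-- The monomial quasisymmetric function
`M_α = ∑_{j 0 < j 1 < ⋯} x_{j 0}^{α_1} x_{j 1}^{α_2} ⋯`. -/
def M (K : Type*) [Field K] (α : List ℕ+) : MvPowerSeries ℕ K :=
  fun d => if ∃ j : Fin α.length → ℕ, StrictMono j ∧ d = expo α j then 1 else 0

/-- The fundamental quasisymmetric function `F_α`, the (finite) sum of `M_β` over all compositions
`β` that refine `α`. -/
def fundamental (K : Type*) [Field K] (α : List ℕ+) : MvPowerSeries ℕ K :=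
  ∑ᶠ β ∈ {β : List ℕ+ | Coarser α β}, M K β

/-! ## The duality between `NSym` and `QSym` -/

/-- The bilinear pairing of `NSym` with `QSym` for which `(H_α)` and `(M_α)` are dual bases. For
quasisymmetric `G`, the coefficient of `M_α` in `G` is the coefficient of `x^α` in `G`. -/
def pairing {K : Type*} [Field K] (X : NSym K) (G : MvPowerSeries ℕ K) : K :=
  ((FreeAlgebra.basisFreeMonoid K ℕ+).repr X).sum
    (fun α c => c * MvPowerSeries.coeff (expo₀ (FreeMonoid.toList α)) G)

/-- The operator `F^⊥` on `NSym` that is adjoint to multiplication by `F` on `QSym`, written in the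
dual bases; the sum is finite by `finite_support_perp`, and `pairing_perp` and `eq_perp` show that
`F^⊥ X` is the only element with `⟨F^⊥ X, G⟩ = ⟨X, F G⟩` for all quasisymmetric `G`. -/
def perp {K : Type*} [Field K] (F : MvPowerSeries ℕ K) (X : NSym K) : NSym K :=
  ∑ᶠ γ : List ℕ+, pairing X (F * M K γ) • Hcomp K γ

/-! ## Creation operators and immaculate functions -/

/-- The noncommutative Bernstein operator `𝔹_m = ∑_{i ≥ 0} (-1)^i H_{m+i} F_{1^i}^⊥`. Applied to any
`X` the sum is finite, by `finite_support_bernstein`. -/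
def bernstein {K : Type*} [Field K] (m : ℤ) (X : NSym K) : NSym K :=
  ∑ᶠ i : ℕ, (-1 : K) ^ i • (H K (m + i) * perp (fundamental K (List.replicate i 1)) X)

/-- The immaculate function `𝔖_μ = 𝔹_{μ_1} ⋯ 𝔹_{μ_k}(1)` of an integer sequence `μ`. -/
def immaculate (K : Type*) [Field K] (μ : List ℤ) : NSym K :=
  μ.foldr (fun m X => bernstein m X) 1

/-! ## The sums above are finite, and the operators are what they are said to be -/

theorem Coarser.sum_eq {β α : List ℕ+} (h : Coarser β α) :
    (β.map (fun a : ℕ+ => (a : ℕ))).sum = (α.map (fun a : ℕ+ => (a : ℕ))).sum := by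
  obtain ⟨b, -, rfl, h⟩ := h
  rw [h, List.map_flatten, List.sum_flatten, List.map_map]
  rfl

theorem Coarser.length_le {β α : List ℕ+} (h : Coarser β α) : β.length ≤ α.length := by
  obtain ⟨b, hb, rfl, h⟩ := h
  have h1 : β.length = b.length := by simpa using congrArg List.length h
  rw [h1]
  clear h h1
  induction b with
  | nil => simp
  | cons c b ih =>
    have h2 := ih (fun x hx => hb x (List.mem_cons_of_mem _ hx))
    have h3 : 0 < c.length := List.length_pos_iff.2 (hb c List.mem_cons_self)
    simp only [List.flatten_cons, List.length_append, List.length_cons]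
    omega

theorem finite_sum_eq (n : ℕ) :
    {β : List ℕ+ | (β.map (fun a : ℕ+ => (a : ℕ))).sum = n}.Finite := by
  have hinj : Function.Injective (fun β : List ℕ+ => β.map (fun a : ℕ+ => (a : ℕ))) :=
    List.map_injective_iff.2 PNat.coe_injective
  refine Set.Finite.subset ((Set.finite_range (fun c : Composition n => c.blocks)).preimage
    hinj.injOn) ?_
  intro β hβ
  refine ⟨⟨β.map (fun a : ℕ+ => (a : ℕ)), ?_, hβ⟩, rfl⟩
  intro i hi
  obtain ⟨a, -, rfl⟩ := List.mem_map.1 hi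
  exact a.pos

theorem finite_coarser (α : List ℕ+) : {β : List ℕ+ | Coarser β α}.Finite :=
  (finite_sum_eq _).subset fun _ h => h.sum_eq

theorem finite_finer (α : List ℕ+) : {β : List ℕ+ | Coarser α β}.Finite :=
  (finite_sum_eq _).subset fun _ h => h.sum_eq.symm

theorem H_coe (K : Type*) [Field K] (a : ℕ+) : H K ((a : ℕ) : ℤ) = FreeAlgebra.ι K a := by
  unfold H
  rw [dif_pos (by exact_mod_cast a.pos)]
  rfl

theorem Hcomp_eq (K : Type*) [Field K] (α : List ℕ+) :
    Hcomp K α = FreeAlgebra.basisFreeMonoid K ℕ+ (FreeMonoid.ofList α) := by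
  have h : FreeAlgebra.basisFreeMonoid K ℕ+ (FreeMonoid.ofList α) =
      FreeMonoid.lift (FreeAlgebra.ι K) (FreeMonoid.ofList α) := by
    have h1 : FreeAlgebra.basisFreeMonoid K ℕ+ (FreeMonoid.ofList α) =
      MonoidAlgebra.lift K (FreeAlgebra K ℕ+) (FreeMonoid ℕ+) (FreeMonoid.lift (FreeAlgebra.ι K))
        (MonoidAlgebra.single (FreeMonoid.ofList α) 1) := rfl
    rw [h1, MonoidAlgebra.lift_single, one_smul]
  rw [h, FreeMonoid.lift_ofList]
  unfold Hcomp
  simp only [H_coe]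

theorem expo_cons (a : ℕ+) (α : List ℕ+) (j : Fin (a :: α).length → ℕ) :
    expo (a :: α) j = Finsupp.single (j 0) (a : ℕ) + expo α (fun i => j i.succ) :=
  Fin.sum_univ_succ (n := α.length) _

theorem expo_apply_of_lt (α : List ℕ+) (j : Fin α.length → ℕ) (n : ℕ) (h : ∀ i, n < j i) :
    expo α j n = 0 := by
  unfold expo
  rw [Finsupp.finsetSum_apply]
  exact Finset.sum_eq_zero fun i _ => Finsupp.single_eq_of_ne (h i).ne

theorem expo_cons_apply_of_lt (a : ℕ+) (α : List ℕ+) (j : Fin (a :: α).length → ℕ)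
    (hj : StrictMono j) (n : ℕ) (h : n < j 0) : expo (a :: α) j n = 0 :=
  expo_apply_of_lt _ _ _ fun i => h.trans_le (hj.monotone (Fin.zero_le i))

theorem expo_cons_apply_zero (a : ℕ+) (α : List ℕ+) (j : Fin (a :: α).length → ℕ)
    (hj : StrictMono j) : expo (a :: α) j (j 0) = a := by
  rw [expo_cons, Finsupp.add_apply, Finsupp.single_eq_same,
    expo_apply_of_lt _ _ _ fun i => hj (Fin.succ_pos i), add_zero]

theorem expo_unique (α : List ℕ+) : ∀ (β : List ℕ+) (j : Fin α.length → ℕ)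
    (j' : Fin β.length → ℕ), StrictMono j → StrictMono j' → expo α j = expo β j' → α = β := by
  induction α with
  | nil =>
    intro β j j' _ hj' h
    cases β with
    | nil => rfl
    | cons b β =>
      have h1 := expo_cons_apply_zero b β j' hj'
      rw [← h] at h1
      exact absurd h1.symm (by simp [expo])
  | cons a α ih =>
    intro β j j' hj hj' h
    cases β with
    | nil =>
      have h1 := expo_cons_apply_zero a α j hj
      rw [h] at h1
      exact absurd h1.symm (by simp [expo])
    | cons b β =>
      have ha := expo_cons_apply_zero a α j hj
      have hb := expo_cons_apply_zero b β j' hj'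
      have h0 : j 0 = j' 0 := by
        rcases lt_trichotomy (j 0) (j' 0) with hlt | heq | hlt
        · have := expo_cons_apply_of_lt b β j' hj' _ hlt
          rw [← h, ha] at this
          exact absurd this a.pos.ne'
        · exact heq
        · have := expo_cons_apply_of_lt a α j hj _ hlt
          rw [h, hb] at this
          exact absurd this b.pos.ne'
      have hab : a = b := by
        apply PNat.coe_injective
        rw [← ha, ← hb, h, h0]
      subst hab
      rw [expo_cons, expo_cons, h0] at h
      rw [ih β _ _ (fun x y hxy => hj (Fin.succ_lt_succ_iff.2 hxy))
        (fun x y hxy => hj' (Fin.succ_lt_succ_iff.2 hxy)) (add_left_cancel h)]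

theorem expo_exists (d : ℕ →₀ ℕ) :
    ∃ (α : List ℕ+) (j : Fin α.length → ℕ), StrictMono j ∧ (∀ i, j i ∈ d.support) ∧
      d = expo α j := by
  induction d using Finsupp.induction_on_min with
  | zero => exact ⟨[], fun i => i.elim0, fun i => i.elim0, fun i => i.elim0, by simp [expo]⟩
  | single_add n b f hn hb ih =>
    obtain ⟨α, j, hj, hs, rfl⟩ := ih
    have hsup : (Finsupp.single n b + expo α j).support = insert n (expo α j).support := by
      ext c
      by_cases hc : c = n
      · subst hc
        simp [hb]
      · simp [hc]
    refine ⟨(⟨b, Nat.pos_of_ne_zero hb⟩ : ℕ+) :: α, Fin.cons n j, ?_, ?_, ?_⟩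
    · intro x y
      refine Fin.cases ?_ (fun x => ?_) x <;> refine Fin.cases ?_ (fun y => ?_) y
      · intro h
        exact absurd h (lt_irrefl _)
      · intro _
        exact hn _ (hs y)
      · intro h
        exact absurd h (not_lt_of_ge (Fin.zero_le _))
      · intro h
        exact hj (Fin.succ_lt_succ_iff.1 h)
    · intro x
      rw [hsup]
      refine Fin.cases ?_ (fun x => ?_) x
      · exact Finset.mem_insert_self _ _
      · exact Finset.mem_insert_of_mem (hs x)
    · exact (expo_cons (⟨b, Nat.pos_of_ne_zero hb⟩ : ℕ+) α (Fin.cons n j)).symm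

theorem degree_expo (α : List ℕ+) : ∀ j : Fin α.length → ℕ,
    (expo α j).degree = (α.map (fun a : ℕ+ => (a : ℕ))).sum := by
  induction α with
  | nil => simp [expo]
  | cons a α ih =>
    intro j
    rw [expo_cons, map_add, ih, Finsupp.degree_single, List.map_cons, List.sum_cons]

theorem strictMono_val (α : List ℕ+) : StrictMono (fun i : Fin α.length => (i : ℕ)) :=
  fun _ _ h => h

open Classical in
theorem coeff_M {K : Type*} [Field K] (α β : List ℕ+) (j : Fin β.length → ℕ)
    (hj : StrictMono j) :
    MvPowerSeries.coeff (expo β j) (M K α) = if α = β then 1 else 0 := by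
  have h : MvPowerSeries.coeff (expo β j) (M K α) =
      if ∃ j' : Fin α.length → ℕ, StrictMono j' ∧ expo β j = expo α j' then 1 else 0 := rfl
  rw [h]
  refine if_congr ⟨?_, ?_⟩ rfl rfl
  · rintro ⟨j', hj', h⟩
    exact (expo_unique _ _ _ _ hj hj' h).symm
  · rintro rfl
    exact ⟨j, hj, rfl⟩

theorem isQuasisymmetric_M (K : Type*) [Field K] (α : List ℕ+) : IsQuasisymmetric (M K α) := by
  refine ⟨⟨∑ i, ((α.get i : ℕ+) : ℕ), fun d hd => ?_⟩, fun β j hj => ?_⟩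
  · have h : ∃ j' : Fin α.length → ℕ, StrictMono j' ∧ d = expo α j' := by
      by_contra h
      exact hd (if_neg h)
    obtain ⟨j, -, rfl⟩ := h
    unfold expo
    simp [map_sum]
  · rw [coeff_M α β j hj]
    exact (coeff_M α β _ (strictMono_val β)).symm

theorem pairing_Hcomp {K : Type*} [Field K] (β : List ℕ+) (G : MvPowerSeries ℕ K) :
    pairing (Hcomp K β) G = MvPowerSeries.coeff (expo₀ β) G := by
  unfold pairing
  rw [Hcomp_eq, Module.Basis.repr_self, Finsupp.sum_single_index (by simp), one_mul]
  rfl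

open Classical in
/-- `(H_α)` and `(M_β)` are dual bases. -/
theorem pairing_Hcomp_M {K : Type*} [Field K] (α β : List ℕ+) :
    pairing (Hcomp K α) (M K β) = if α = β then 1 else 0 := by
  rw [pairing_Hcomp]
  refine (coeff_M β α _ (strictMono_val α)).trans ?_
  simp only [eq_comm]

theorem pairing_add {K : Type*} [Field K] (X Y : NSym K) (G : MvPowerSeries ℕ K) :
    pairing (X + Y) G = pairing X G + pairing Y G := by
  unfold pairing
  rw [map_add, Finsupp.sum_add_index' (by simp) (by intros; ring)]

theorem pairing_smul {K : Type*} [Field K] (c : K) (X : NSym K) (G : MvPowerSeries ℕ K) :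
    pairing (c • X) G = c * pairing X G := by
  unfold pairing
  rw [map_smul, Finsupp.sum_smul_index (by simp), Finsupp.mul_sum]
  simp only [mul_assoc]

theorem NSym.induction {K : Type*} [Field K] {P : NSym K → Prop} (X : NSym K) (h0 : P 0)
    (hadd : ∀ X Y, P X → P Y → P (X + Y)) (hH : ∀ (c : K) (β : List ℕ+), P (c • Hcomp K β)) :
    P X := by
  rw [← (FreeAlgebra.basisFreeMonoid K ℕ+).linearCombination_repr X]
  refine Finsupp.induction_linear ((FreeAlgebra.basisFreeMonoid K ℕ+).repr X) ?_ ?_ ?_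
  · simpa using h0
  · intro f g hf hg
    rw [map_add]
    exact hadd _ _ hf hg
  · intro β c
    rw [Finsupp.linearCombination_single]
    have := hH c (FreeMonoid.toList β)
    rwa [Hcomp_eq] at this

theorem pairing_zero {K : Type*} [Field K] (G : MvPowerSeries ℕ K) :
    pairing (0 : NSym K) G = 0 := by
  simp [pairing]

open Classical in
theorem pairing_Hcomp_mul_M {K : Type*} [Field K] (F : MvPowerSeries ℕ K) (β γ : List ℕ+) :
    pairing (Hcomp K β) (F * M K γ) = ∑ p ∈ Finset.HasAntidiagonal.antidiagonal (expo₀ β),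
      MvPowerSeries.coeff p.1 F * (if γ = (expo_exists p.2).choose then 1 else 0) := by
  rw [pairing_Hcomp, MvPowerSeries.coeff_mul]
  refine Finset.sum_congr rfl fun p _ => ?_
  congr 1
  obtain ⟨j, hj, -, h⟩ := (expo_exists p.2).choose_spec
  conv_lhs => rw [h]
  exact coeff_M _ _ _ hj

theorem finite_support_pairing {K : Type*} [Field K] (F : MvPowerSeries ℕ K) (X : NSym K) :
    {γ : List ℕ+ | pairing X (F * M K γ) ≠ 0}.Finite := by
  classical
  refine NSym.induction (P := fun X => {γ : List ℕ+ | pairing X (F * M K γ) ≠ 0}.Finite) X ?_ ?_ ?_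
  · simp [pairing_zero]
  · intro X Y hX hY
    refine (hX.union hY).subset fun γ hγ => ?_
    by_contra h
    simp only [Set.mem_union, Set.mem_ofPred_eq, not_or, not_not] at h
    exact hγ (by rw [pairing_add, h.1, h.2, add_zero])
  · intro c β
    refine (((Finset.HasAntidiagonal.antidiagonal (expo₀ β)).image
      (fun p => (expo_exists p.2).choose)).finite_toSet).subset fun γ hγ => ?_
    by_contra h
    refine hγ ?_
    rw [pairing_smul, pairing_Hcomp_mul_M, Finset.sum_eq_zero, mul_zero]
    intro p hp
    rw [if_neg, mul_zero]
    rintro rfl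
    exact h (Finset.mem_coe.2 (Finset.mem_image_of_mem _ hp))

theorem finite_support_perp {K : Type*} [Field K] (F : MvPowerSeries ℕ K) (X : NSym K) :
    (Function.support fun γ : List ℕ+ => pairing X (F * M K γ) • Hcomp K γ).Finite :=
  (finite_support_pairing F X).subset fun γ hγ h => hγ (by simp [h])

theorem perp_zero {K : Type*} [Field K] (F : MvPowerSeries ℕ K) : perp F (0 : NSym K) = 0 := by
  simp [perp, pairing_zero]

theorem perp_add {K : Type*} [Field K] (F : MvPowerSeries ℕ K) (X Y : NSym K) :
    perp F (X + Y) = perp F X + perp F Y := by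
  unfold perp
  rw [← finsum_add_distrib (finite_support_perp F X) (finite_support_perp F Y)]
  simp only [pairing_add, add_smul]

theorem perp_smul {K : Type*} [Field K] (F : MvPowerSeries ℕ K) (c : K) (X : NSym K) :
    perp F (c • X) = c • perp F X := by
  unfold perp
  rw [smul_finsum' c (finite_support_perp F X)]
  simp only [pairing_smul, mul_smul]

theorem pairing_finset_sum {K : Type*} [Field K] {ι : Type*} (s : Finset ι) (f : ι → NSym K)
    (G : MvPowerSeries ℕ K) : pairing (∑ i ∈ s, f i) G = ∑ i ∈ s, pairing (f i) G := by
  classical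
  induction s using Finset.induction_on with
  | empty => simp [pairing_zero]
  | insert a s ha ih => rw [Finset.sum_insert ha, Finset.sum_insert ha, pairing_add, ih]

/-- The defining property of the adjoint operator. -/
theorem pairing_perp {K : Type*} [Field K] (F : MvPowerSeries ℕ K) (X : NSym K)
    (G : MvPowerSeries ℕ K) (hG : IsQuasisymmetric G) :
    pairing (perp F X) G = pairing X (F * G) := by
  classical
  refine NSym.induction (P := fun X => pairing (perp F X) G = pairing X (F * G)) X ?_ ?_ ?_
  · rw [perp_zero, pairing_zero, pairing_zero]
  · intro X Y hX hY
    rw [perp_add, pairing_add, pairing_add, hX, hY]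
  · intro c β
    rw [perp_smul, pairing_smul, pairing_smul]
    congr 1
    have hsub : (Function.support fun γ : List ℕ+ =>
        pairing (Hcomp K β) (F * M K γ) • Hcomp K γ) ⊆
        ((Finset.HasAntidiagonal.antidiagonal (expo₀ β)).image (fun p => (expo_exists p.2).choose) :
          Finset (List ℕ+)) := by
      intro γ hγ
      by_contra h
      refine hγ ?_
      simp only
      rw [pairing_Hcomp_mul_M, Finset.sum_eq_zero, zero_smul]
      intro p hp
      rw [if_neg, mul_zero]
      rintro rfl
      exact h (Finset.mem_coe.2 (Finset.mem_image_of_mem _ hp))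
    unfold perp
    rw [finsum_eq_sum_of_support_subset _ hsub, pairing_finset_sum]
    simp only [pairing_smul, pairing_Hcomp_mul_M, Finset.sum_mul]
    rw [Finset.sum_comm, pairing_Hcomp, MvPowerSeries.coeff_mul]
    refine Finset.sum_congr rfl fun p hp => ?_
    obtain ⟨j, hj, -, h⟩ := (expo_exists p.2).choose_spec
    rw [Finset.sum_eq_single (expo_exists p.2).choose]
    · rw [if_pos rfl, mul_one, pairing_Hcomp, ← hG.2 _ j hj, ← h]
    · intro γ _ hγ
      rw [if_neg hγ, mul_zero, zero_mul]
    · intro h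
      exact absurd (Finset.mem_image_of_mem _ hp) h

/-- The pairing is nondegenerate on the side of `NSym`. -/
theorem eq_perp {K : Type*} [Field K] (F : MvPowerSeries ℕ K) (X Y : NSym K)
    (h : ∀ G : MvPowerSeries ℕ K, IsQuasisymmetric G → pairing Y G = pairing X (F * G)) :
    Y = perp F X := by
  classical
  apply (FreeAlgebra.basisFreeMonoid K ℕ+).repr.injective
  have key : ∀ (Z : NSym K) (γ : List ℕ+), pairing Z (M K γ) =
      (FreeAlgebra.basisFreeMonoid K ℕ+).repr Z (FreeMonoid.ofList γ) := by
    intro Z γ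
    refine NSym.induction (P := fun Z => pairing Z (M K γ) =
      (FreeAlgebra.basisFreeMonoid K ℕ+).repr Z (FreeMonoid.ofList γ)) Z ?_ ?_ ?_
    · simp [pairing_zero]
    · intro X Y hX hY
      rw [pairing_add, map_add, hX, hY, Finsupp.add_apply]
    · intro c β
      rw [pairing_smul, pairing_Hcomp_M, map_smul, Hcomp_eq, Module.Basis.repr_self,
        Finsupp.smul_apply, Finsupp.single_apply, smul_eq_mul]
      congr 1
      exact if_congr FreeMonoid.ofList.injective.eq_iff.symm rfl rfl
  ext γ
  have h1 := h _ (isQuasisymmetric_M K (FreeMonoid.toList γ))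
  rw [← pairing_perp F X _ (isQuasisymmetric_M K (FreeMonoid.toList γ)), key, key] at h1
  exact h1

theorem degree_of_coeff_fundamental {K : Type*} [Field K] (i : ℕ) (d : ℕ →₀ ℕ)
    (h : MvPowerSeries.coeff d (fundamental K (List.replicate i 1)) ≠ 0) : d.degree = i := by
  unfold fundamental at h
  rw [finsum_mem_eq_finite_toFinset_sum _ (finite_finer _), map_sum] at h
  obtain ⟨β, hβ, h⟩ := Finset.exists_ne_zero_of_sum_ne_zero h
  have hc : Coarser (List.replicate i 1) β :=
    (Set.Finite.mem_toFinset (finite_finer (List.replicate i 1))).1 hβ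
  have hs := hc.sum_eq
  have h2 : ∃ j' : Fin β.length → ℕ, StrictMono j' ∧ d = expo β j' := by
    by_contra h'
    exact h (if_neg h')
  obtain ⟨j, -, rfl⟩ := h2
  rw [degree_expo, ← hs]
  simp

theorem finite_support_bernstein {K : Type*} [Field K] (m : ℤ) (X : NSym K) :
    (Function.support fun i : ℕ => (-1 : K) ^ i •
      (H K (m + i) * perp (fundamental K (List.replicate i 1)) X)).Finite := by
  classical
  suffices h : {i : ℕ | perp (fundamental K (List.replicate i 1)) X ≠ 0}.Finite by
    refine h.subset fun i hi h => hi ?_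
    simp only
    rw [h, mul_zero, smul_zero]
  refine NSym.induction (P := fun X => {i : ℕ | perp (fundamental K (List.replicate i 1)) X ≠ 0}.Finite) X ?_ ?_ ?_
  · simp [perp_zero]
  · intro X Y hX hY
    refine (hX.union hY).subset fun γ hγ => ?_
    by_contra h
    simp only [Set.mem_union, Set.mem_ofPred_eq, not_or, not_not] at h
    exact hγ (by rw [perp_add, h.1, h.2, add_zero])
  · intro c β
    refine (((Finset.HasAntidiagonal.antidiagonal (expo₀ β)).image
      (fun p => p.1.degree)).finite_toSet).subset fun i hi => ?_
    by_contra h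
    refine hi ?_
    rw [perp_smul]
    unfold perp
    rw [finsum_eq_zero_of_forall_eq_zero, smul_zero]
    intro γ
    rw [pairing_Hcomp_mul_M, Finset.sum_eq_zero, zero_smul]
    intro p hp
    by_cases h0 : MvPowerSeries.coeff p.1 (fundamental K (List.replicate i 1)) = 0
    · rw [h0, zero_mul]
    · exact absurd (Finset.mem_coe.2 (Finset.mem_image.2
        ⟨p, hp, degree_of_coeff_fundamental i _ h0⟩)) h

end NCSym

end

noncomputable section

namespace NCSym

open Finset

/-! Two facts carry the theorem: a Jacobi–Trudi formula for immaculate functions, and a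
sign-reversing swap that turns complete functions into ribbons one factor at a time.

Jacobi–Trudi (`immaculate_eq_Hdet`). The function `F_{1^i}` is the elementary function `M_{1^i}`,
and its adjoint obeys the product rule `e_{i+1}^⊥(H_a X) = H_a e_{i+1}^⊥ X + H_{a-1} e_i^⊥ X`
(`perp_elementary_succ_H_mul`). Hence `𝔹_m` applied to a product of `k` factors `H` is a signed sum
over the subsets of factors whose index drops by 1. On a row determinant these drops act on columns,
and all subsets except the `k + 1` initial segments produce two equal columns. What survives is a
Laplace expansion along a new first row, so 𝔖 is the signed sum over σ of products of `H`.

From `H` to `R`. Consider the signed sum over σ of `R_{(l_1,…,l_i)} H_{l_{i+1}} ⋯ H_{l_k}`, where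
`l` is the shifted sequence of σ. At `i = 0` it is the determinant, at `i = k` the ribbon sum. By
`R_{(g,a)} H_b = R_{(g,a,b)} + R_{(g,a+b)}`, with the degenerate cases in `ribbon_concat_mul_H_sub`,
passing to the next `i` changes each term by something that depends only on `a + b` and on whether
`0 < a` and `0 ≤ b`. For a rectangle both data are unchanged when the two neighbouring values of σ
are exchanged, while the sign flips; so the changes cancel in pairs. -/

variable {K : Type*} [Field K]

/-! ### Slicing power series by the exponent of the first variable -/

/-- The exponent vector of `x_0^a` times the monomial with exponent vector `d` in the variables
`x_1, x_2, …`. -/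
def consExpo (a : ℕ) (d : ℕ →₀ ℕ) : ℕ →₀ ℕ := Finsupp.single 0 a + d.mapDomain Nat.succ

theorem consExpo_zero_apply (a : ℕ) (d : ℕ →₀ ℕ) : consExpo a d 0 = a := by
  rw [consExpo, Finsupp.add_apply, Finsupp.single_eq_same, Finsupp.mapDomain_of_notMem_range, add_zero]
  simp

theorem consExpo_succ_apply (a : ℕ) (d : ℕ →₀ ℕ) (n : ℕ) : consExpo a d (n + 1) = d n := by
  rw [consExpo, Finsupp.add_apply, Finsupp.single_eq_of_ne (by omega), zero_add]
  exact Finsupp.mapDomain_apply Nat.succ_injective d n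

theorem consExpo_add (a b : ℕ) (d e : ℕ →₀ ℕ) :
    consExpo a d + consExpo b e = consExpo (a + b) (d + e) := by
  simp only [consExpo, Finsupp.single_add, Finsupp.mapDomain_add]
  abel

theorem consExpo_surj (d : ℕ →₀ ℕ) :
    consExpo (d 0) (d.comapDomain Nat.succ Nat.succ_injective.injOn) = d := by
  ext n
  cases n with
  | zero => exact consExpo_zero_apply _ _
  | succ n => rw [consExpo_succ_apply]; rfl

theorem consExpo_inj {a b : ℕ} {d e : ℕ →₀ ℕ} (h : consExpo a d = consExpo b e) :
    a = b ∧ d = e := by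
  constructor
  · rw [← consExpo_zero_apply a d, h, consExpo_zero_apply]
  · ext n
    rw [← consExpo_succ_apply a d, h, consExpo_succ_apply]

theorem degree_consExpo (a : ℕ) (d : ℕ →₀ ℕ) : (consExpo a d).degree = a + d.degree := by
  obtain ⟨α, j, -, -, rfl⟩ := expo_exists d
  simp only [consExpo, expo, Finsupp.mapDomain_finsetSum, Finsupp.mapDomain_single, map_add,
    map_sum, Finsupp.degree_single]

theorem consExpo_zero_expo (α : List ℕ+) (j : Fin α.length → ℕ) :
    consExpo 0 (expo α j) = expo α (fun i => (j i).succ) := by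
  simp only [consExpo, expo, Finsupp.mapDomain_finsetSum, Finsupp.mapDomain_single,
    Finsupp.single_zero, zero_add]

theorem consExpo_expo (a : ℕ+) (α : List ℕ+) (j : Fin α.length → ℕ) :
    consExpo a (expo α j) =
      expo (a :: α) (Fin.cons (α := fun _ => ℕ) 0 (fun i => (j i).succ)) := by
  rw [expo_cons]
  have := consExpo_zero_expo α j
  simp only [consExpo, Finsupp.single_zero, zero_add] at this
  simp only [consExpo, this]
  rfl

theorem expo₀_cons (a : ℕ+) (α : List ℕ+) : expo₀ (a :: α) = consExpo a (expo₀ α) := by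
  unfold expo₀
  rw [consExpo_expo]
  congr 1
  ext i
  refine Fin.cases ?_ (fun i => ?_) i <;> simp

theorem strictMono_cons_succ (n : ℕ) (j : Fin n → ℕ) (hj : StrictMono j) :
    StrictMono (Fin.cons (α := fun _ => ℕ) 0 (fun i => (j i).succ)) := by
  intro x y
  refine Fin.cases ?_ (fun x => ?_) x <;> refine Fin.cases ?_ (fun y => ?_) y
  · intro h; exact absurd h (lt_irrefl _)
  · intro _; simp
  · intro h; exact absurd h (not_lt_of_ge (Fin.zero_le _))
  · intro h; simpa using hj (Fin.succ_lt_succ_iff.1 h)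

/-- The coefficient of `x_0^a` in `G`, with the remaining variables renumbered from `0`. -/
def slice (a : ℕ) (G : MvPowerSeries ℕ K) : MvPowerSeries ℕ K :=
  fun d => MvPowerSeries.coeff (consExpo a d) G

theorem coeff_slice (a : ℕ) (G : MvPowerSeries ℕ K) (d : ℕ →₀ ℕ) :
    MvPowerSeries.coeff d (slice a G) = MvPowerSeries.coeff (consExpo a d) G := rfl

/-- Slicing at exponent 0 only shifts the variables by one place, which a quasisymmetric series
cannot detect. -/
theorem coeff_slice_zero (G : MvPowerSeries ℕ K) (hG : IsQuasisymmetric G) (α : List ℕ+)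
    (j : Fin α.length → ℕ) (hj : StrictMono j) :
    MvPowerSeries.coeff (expo α j) (slice 0 G) = MvPowerSeries.coeff (expo₀ α) G := by
  rw [coeff_slice, consExpo_zero_expo]
  exact hG.2 _ _ fun x y h => Nat.succ_lt_succ (hj h)

theorem isQuasisymmetric_slice (a : ℕ) (G : MvPowerSeries ℕ K) (hG : IsQuasisymmetric G) :
    IsQuasisymmetric (slice a G) := by
  refine ⟨?_, fun α j hj => ?_⟩
  · obtain ⟨N, hN⟩ := hG.1
    refine ⟨N, fun d hd => ?_⟩
    have := hN _ hd
    rw [degree_consExpo] at this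
    omega
  · rcases Nat.eq_zero_or_pos a with rfl | ha
    · rw [coeff_slice_zero G hG α j hj, expo₀, coeff_slice_zero G hG α _ (strictMono_val α), expo₀]
    · have h := hG.2 ((⟨a, ha⟩ : ℕ+) :: α) _ (strictMono_cons_succ _ j hj)
      have e1 := consExpo_expo (⟨a, ha⟩ : ℕ+) α j
      have e2 := expo₀_cons (⟨a, ha⟩ : ℕ+) α
      simp only [PNat.mk_coe] at e1 e2
      rw [coeff_slice, coeff_slice, e1, ← e2, h]

/-- This is the product rule for the coproduct dual to multiplication in `NSym`: a factorisation of
a monomial splits the exponent of `x_0` and the remaining exponents independently. -/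
theorem slice_mul (a : ℕ) (F G : MvPowerSeries ℕ K) :
    slice a (F * G) = ∑ p ∈ antidiagonal a, slice p.1 F * slice p.2 G := by
  ext d
  rw [coeff_slice, map_sum, MvPowerSeries.coeff_mul]
  simp only [MvPowerSeries.coeff_mul, coeff_slice]
  rw [← Finset.sum_product']
  symm
  refine Finset.sum_nbij (fun x => (consExpo x.1.1 x.2.1, consExpo x.1.2 x.2.2)) ?_ ?_ ?_ ?_
  · rintro ⟨⟨r, s⟩, ⟨p, q⟩⟩ h
    simp only [mem_product, HasAntidiagonal.mem_antidiagonal] at h ⊢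
    rw [consExpo_add, h.1, h.2]
  · rintro ⟨⟨r, s⟩, ⟨p, q⟩⟩ - ⟨⟨r', s'⟩, ⟨p', q'⟩⟩ - h
    simp only [Prod.mk.injEq] at h ⊢
    have h1 := consExpo_inj h.1
    have h2 := consExpo_inj h.2
    exact ⟨⟨h1.1, h2.1⟩, h1.2, h2.2⟩
  · rintro ⟨u, v⟩ h
    rw [mem_coe, HasAntidiagonal.mem_antidiagonal] at h
    simp only at h
    refine ⟨((u 0, v 0), (u.comapDomain Nat.succ Nat.succ_injective.injOn,
      v.comapDomain Nat.succ Nat.succ_injective.injOn)), ?_, ?_⟩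
    · rw [← consExpo_surj u, ← consExpo_surj v, consExpo_add] at h
      have := consExpo_inj h
      simpa only [mem_coe, mem_product, HasAntidiagonal.mem_antidiagonal] using this
    · simp only [consExpo_surj]
  · rintro _ _
    rfl

/-! ### Left multiplication by `H_a` is adjoint to slicing -/

theorem pairing_add_right (X : NSym K) (F G : MvPowerSeries ℕ K) :
    pairing X (F + G) = pairing X F + pairing X G := by
  unfold pairing
  simp only [map_add, mul_add]
  exact Finsupp.sum_add

theorem H_zero : H K 0 = 1 := by simp [H]

theorem H_of_neg {a : ℤ} (ha : a < 0) : H K a = 0 := by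
  rw [H, dif_neg (by omega), if_neg (by omega)]

theorem Hcomp_nil : Hcomp K [] = 1 := rfl

theorem Hcomp_cons (a : ℕ+) (α : List ℕ+) :
    Hcomp K (a :: α) = H K ((a : ℕ) : ℤ) * Hcomp K α := by
  simp [Hcomp]

/-- The pairing reads coefficients only at the monomials `x^α`, and prepending the part `a` to `α`
puts `x_0^a` in front. No quasisymmetry is involved, so `G` may be a product whose quasisymmetry has
not been established. -/
theorem pairing_H_mul_of_pos (a : ℕ+) (Y : NSym K) (G : MvPowerSeries ℕ K) :
    pairing (H K ((a : ℕ) : ℤ) * Y) G = pairing Y (slice a G) := by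
  refine NSym.induction (P := fun Y => pairing (H K ((a : ℕ) : ℤ) * Y) G = pairing Y (slice a G))
    Y ?_ ?_ ?_
  · rw [mul_zero, pairing_zero, pairing_zero]
  · intro X Y hX hY
    rw [mul_add, pairing_add, pairing_add, hX, hY]
  · intro c β
    rw [mul_smul_comm, pairing_smul, pairing_smul, ← Hcomp_cons, pairing_Hcomp, pairing_Hcomp,
      expo₀_cons, coeff_slice]

theorem pairing_slice_zero (Y : NSym K) (G : MvPowerSeries ℕ K) (hG : IsQuasisymmetric G) :
    pairing Y (slice 0 G) = pairing Y G := by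
  refine NSym.induction (P := fun Y => pairing Y (slice 0 G) = pairing Y G) Y ?_ ?_ ?_
  · rw [pairing_zero, pairing_zero]
  · intro X Y hX hY
    rw [pairing_add, pairing_add, hX, hY]
  · intro c β
    rw [pairing_smul, pairing_smul, pairing_Hcomp, pairing_Hcomp]
    conv_lhs => rw [expo₀, coeff_slice_zero G hG β _ (strictMono_val β)]

theorem pairing_H_mul (a : ℕ) (Y : NSym K) (G : MvPowerSeries ℕ K) (hG : IsQuasisymmetric G) :
    pairing (H K (a : ℤ) * Y) G = pairing Y (slice a G) := by
  rcases Nat.eq_zero_or_pos a with rfl | ha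
  · rw [Nat.cast_zero, H_zero, one_mul, pairing_slice_zero Y G hG]
  · exact pairing_H_mul_of_pos ⟨a, ha⟩ Y G

/-! ### Elementary functions and the product rule for their adjoints -/

theorem coarser_replicate_one {i : ℕ} {β : List ℕ+} :
    Coarser (List.replicate i 1) β ↔ β = List.replicate i 1 := by
  constructor
  · intro h
    have h1 := h.sum_eq
    have h2 := h.length_le
    simp only [List.map_replicate, List.sum_replicate, PNat.one_coe, smul_eq_mul, mul_one,
      List.length_replicate] at h1 h2
    have key : ∀ γ : List ℕ+, γ.length ≤ (γ.map (fun a : ℕ+ => (a : ℕ))).sum ∧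
        ((γ.map (fun a : ℕ+ => (a : ℕ))).sum ≤ γ.length → γ = List.replicate γ.length 1) := by
      intro γ
      induction γ with
      | nil => simp
      | cons c γ ih =>
        have hc := c.pos
        simp only [List.map_cons, List.sum_cons, List.length_cons]
        refine ⟨by omega, fun h => ?_⟩
        have hc1 : c = 1 := PNat.coe_injective (by rw [PNat.one_coe]; omega)
        rw [List.replicate_succ, ← ih.2 (by omega), hc1]
    have h3 := (key β).2 (by omega)
    have h4 := (key β).1
    have h5 : β.length = i := by omega
    rwa [h5] at h3
  · rintro rfl
    refine ⟨(List.replicate i 1).map (fun a => [a]), ?_, ?_, ?_⟩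
    · intro b hb
      obtain ⟨a, -, rfl⟩ := List.mem_map.1 hb
      simp
    · induction i with
      | zero => rfl
      | succ n ih => simp
    · simp

theorem fundamental_replicate_one (i : ℕ) :
    fundamental K (List.replicate i 1) = M K (List.replicate i 1) := by
  unfold fundamental
  have : {β : List ℕ+ | Coarser (List.replicate i 1) β} = {List.replicate i 1} := by
    ext β
    exact coarser_replicate_one
  rw [this, finsum_mem_singleton]

theorem slice_zero_M (α : List ℕ+) : slice 0 (M K α) = M K α := by
  classical
  ext d
  obtain ⟨β, j, hj, -, rfl⟩ := expo_exists d
  rw [coeff_slice, consExpo_zero_expo, coeff_M _ _ _ hj,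
    coeff_M _ _ _ (fun x y h => Nat.succ_lt_succ (hj h))]

theorem slice_M_cons (a : ℕ+) (α : List ℕ+) : slice a (M K (a :: α)) = M K α := by
  classical
  ext d
  obtain ⟨β, j, hj, -, rfl⟩ := expo_exists d
  rw [coeff_slice, consExpo_expo, coeff_M _ _ _ hj, coeff_M _ _ _ (strictMono_cons_succ _ j hj)]
  simp

theorem slice_M_cons_of_ne {a b : ℕ+} (h : a ≠ b) (α : List ℕ+) :
    slice b (M K (a :: α)) = 0 := by
  classical
  ext d
  obtain ⟨β, j, hj, -, rfl⟩ := expo_exists d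
  rw [coeff_slice, consExpo_expo, coeff_M _ _ _ (strictMono_cons_succ _ j hj)]
  simp [h]

theorem M_nil : M K [] = 1 := by
  classical
  ext d
  obtain ⟨β, j, hj, -, rfl⟩ := expo_exists d
  rw [coeff_M _ _ _ hj, MvPowerSeries.coeff_one]
  refine if_congr ⟨?_, ?_⟩ rfl rfl
  · rintro rfl
    simp [expo]
  · intro h
    refine expo_unique [] β (fun i => i.elim0) j (fun i => i.elim0) hj ?_
    rw [h]
    simp [expo]

/-- The elementary function `M_{1^{i+1}}` is squarefree, so in `slice_mul` only its slices at 0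
(itself) and at 1 (`M_{1^i}`) survive. -/
theorem slice_succ_elementary_mul (i a : ℕ) (G : MvPowerSeries ℕ K) :
    slice (a + 1) (M K (List.replicate (i + 1) 1) * G) =
      M K (List.replicate (i + 1) 1) * slice (a + 1) G + M K (List.replicate i 1) * slice a G := by
  rw [slice_mul, Finset.Nat.sum_antidiagonal_succ, slice_zero_M]
  congr 1
  cases a with
  | zero =>
    simp only [HasAntidiagonal.antidiagonal_zero, sum_singleton, zero_add]
    rw [List.replicate_succ]
    exact congrArg (· * _) (slice_M_cons 1 _)
  | succ a =>
    rw [Finset.Nat.sum_antidiagonal_succ, Finset.sum_eq_zero, add_zero]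
    · rw [List.replicate_succ]
      exact congrArg (· * _) (slice_M_cons 1 _)
    · rintro ⟨r, s⟩ -
      rw [List.replicate_succ]
      have h : (1 : ℕ+) ≠ ⟨r + 1 + 1, by omega⟩ := by
        intro h
        have := congrArg (fun x : ℕ+ => (x : ℕ)) h
        simp at this
      have h1 := slice_M_cons_of_ne (K := K) h (List.replicate i 1)
      simp only [PNat.mk_coe] at h1
      rw [h1, zero_mul]

theorem perp_elementary_zero (X : NSym K) :
    perp (fundamental K (List.replicate 0 1)) X = X := by
  symm
  apply eq_perp
  intro G _
  rw [fundamental_replicate_one, List.replicate_zero, M_nil, one_mul]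

theorem perp_elementary_succ_one (i : ℕ) :
    perp (fundamental K (List.replicate (i + 1) 1)) (1 : NSym K) = 0 := by
  classical
  symm
  apply eq_perp
  intro G _
  have h0 : expo₀ [] = 0 := by simp [expo₀, expo]
  have h1 : MvPowerSeries.coeff 0 (M K (List.replicate (i + 1) 1)) = 0 := by
    have := coeff_M (K := K) (List.replicate (i + 1) 1) [] (fun i => i.elim0) (fun i => i.elim0)
    rw [if_neg (by simp [List.replicate_succ])] at this
    simpa [expo] using this
  rw [fundamental_replicate_one, pairing_zero, ← Hcomp_nil, pairing_Hcomp, h0,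
    MvPowerSeries.coeff_mul, HasAntidiagonal.antidiagonal_zero, sum_singleton, h1, zero_mul]

/-- For `a > 0` this is the dual of `slice_succ_elementary_mul`. It persists for `a ≤ 0` thanks to
the conventions `H_0 = 1` and `H_a = 0` for `a < 0`, so products indexed by arbitrary integers can
be treated uniformly. -/
theorem perp_elementary_succ_H_mul (i : ℕ) (a : ℤ) (X : NSym K) :
    perp (fundamental K (List.replicate (i + 1) 1)) (H K a * X) =
      H K a * perp (fundamental K (List.replicate (i + 1) 1)) X +
        H K (a - 1) * perp (fundamental K (List.replicate i 1)) X := by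
  rcases lt_trichotomy a 0 with ha | rfl | ha
  · rw [H_of_neg ha, H_of_neg (by omega : a - 1 < 0)]
    simp [perp_zero]
  · rw [H_zero, H_of_neg (by omega : (0 : ℤ) - 1 < 0)]
    simp
  · obtain ⟨n, rfl⟩ : ∃ n : ℕ, a = ((n + 1 : ℕ) : ℤ) := ⟨(a - 1).toNat, by omega⟩
    symm
    apply eq_perp
    intro G hG
    have h := pairing_H_mul_of_pos (K := K) (⟨n + 1, by omega⟩ : ℕ+) X
      (M K (List.replicate (i + 1) 1) * G)
    simp only [PNat.mk_coe] at h
    have h2 : ((n + 1 : ℕ) : ℤ) - 1 = (n : ℕ) := by push_cast; ring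
    rw [pairing_add, pairing_H_mul _ _ _ hG, h2, pairing_H_mul _ _ _ hG,
      pairing_perp _ _ _ (isQuasisymmetric_slice _ _ hG),
      pairing_perp _ _ _ (isQuasisymmetric_slice _ _ hG), fundamental_replicate_one,
      fundamental_replicate_one, h, slice_succ_elementary_mul, pairing_add_right]

/-! ### Creation operators on products of complete functions -/

theorem bernstein_add (m : ℤ) (X Y : NSym K) :
    bernstein m (X + Y) = bernstein m X + bernstein m Y := by
  unfold bernstein
  rw [← finsum_add_distrib (finite_support_bernstein m X) (finite_support_bernstein m Y)]
  simp only [perp_add, mul_add, smul_add]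

theorem bernstein_smul (m : ℤ) (c : K) (X : NSym K) :
    bernstein m (c • X) = c • bernstein m X := by
  unfold bernstein
  rw [smul_finsum' c (finite_support_bernstein m X)]
  simp only [perp_smul, mul_smul_comm, smul_comm c]

/-- The creation operator `𝔹_m` as a linear map. -/
def bernsteinLinear (m : ℤ) : NSym K →ₗ[K] NSym K where
  toFun := bernstein m
  map_add' := bernstein_add m
  map_smul' := bernstein_smul m

theorem bernstein_sum_smul (m : ℤ) {ι : Type*} (s : Finset ι) (c : ι → K) (X : ι → NSym K) :
    bernstein m (∑ i ∈ s, c i • X i) = ∑ i ∈ s, c i • bernstein m (X i) := by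
  have := map_sum (bernsteinLinear m) (fun i => c i • X i) s
  simp only [map_smul] at this
  exact this

variable (K) in
/-- The product `H_{c_1} H_{c_2} ⋯` for an integer sequence `c`. -/
def Hprod (c : List ℤ) : NSym K := (c.map (H K)).prod

theorem Hprod_nil : Hprod K [] = 1 := rfl

theorem Hprod_cons (a : ℤ) (c : List ℤ) : Hprod K (a :: c) = H K a * Hprod K c := by
  simp [Hprod]

/-- Iterating the product rule, each factor either keeps its index or drops it by 1; `e` records
which factors drop. -/
theorem perp_elementary_Hprod (k : ℕ) (c : Fin k → ℤ) (i : ℕ) :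
    perp (fundamental K (List.replicate i 1)) (Hprod K (List.ofFn c)) =
      ∑ e : Fin k → Fin 2, if ∑ j, (e j : ℕ) = i then
        Hprod K (List.ofFn fun j => c j - (e j : ℕ)) else 0 := by
  induction k generalizing i with
  | zero =>
    rw [Fintype.sum_unique, List.ofFn_zero, Hprod_nil]
    cases i with
    | zero => rw [perp_elementary_zero]; simp [Hprod_nil]
    | succ i => rw [perp_elementary_succ_one]; simp
  | succ k ih =>
    rw [← (Fin.consEquiv fun _ => Fin 2).sum_comp, Fintype.sum_prod_type, Fin.sum_univ_two]
    simp only [Fin.consEquiv_apply, Fin.sum_univ_succ, Fin.cons_zero, Fin.cons_succ,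
      List.ofFn_succ, Hprod_cons, Fin.val_zero, Fin.val_one, Nat.cast_zero, Nat.cast_one,
      sub_zero, zero_add]
    cases i with
    | zero =>
      rw [perp_elementary_zero]
      have h := ih (fun j => c j.succ) 0
      rw [perp_elementary_zero] at h
      conv_lhs => rw [h]
      simp [mul_sum]
    | succ i =>
      rw [perp_elementary_succ_H_mul, ih, ih, mul_sum, mul_sum]
      congr 1
      · simp
      · refine sum_congr rfl fun e _ => ?_
        rw [mul_ite, mul_zero]
        exact if_congr (by omega) rfl rfl

theorem bernstein_Hprod (m : ℤ) (k : ℕ) (c : Fin k → ℤ) :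
    bernstein m (Hprod K (List.ofFn c)) =
      ∑ e : Fin k → Fin 2, (-1 : K) ^ (∑ j, (e j : ℕ)) •
        (H K (m + (∑ j, (e j : ℕ) : ℕ)) * Hprod K (List.ofFn fun j => c j - (e j : ℕ))) := by
  unfold bernstein
  simp only [perp_elementary_Hprod, mul_sum, smul_sum, mul_ite, mul_zero, smul_ite, smul_zero]
  rw [finsum_sum_comm]
  · refine sum_congr rfl fun e _ => ?_
    -- A choice `e` of dropped factors occurs for exactly one `i`, the number of drops.
    rw [finsum_eq_single _ (∑ j, (e j : ℕ))]
    · rw [if_pos rfl]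
    · intro i hi
      rw [if_neg (Ne.symm hi)]
  · intro e _
    refine (Set.finite_singleton (∑ j, (e j : ℕ))).subset fun i hi => ?_
    by_contra h
    exact hi (if_neg fun h' => h h'.symm)

/-! ### Row determinants and the Jacobi–Trudi formula -/

variable (K) in
/-- The row determinant `∑_σ ε(σ) H_{c_1 + v_{σ 1}} H_{c_2 + v_{σ 2}} ⋯`. -/
def Hdet {k : ℕ} (c v : Fin k → ℤ) : NSym K :=
  ∑ σ : Equiv.Perm (Fin k), ((Equiv.Perm.sign σ : ℤ) : K) •
    Hprod K (List.ofFn fun i => c i + v (σ i))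

/-- The factors stay in row order whatever σ is, so antisymmetry in the columns holds although the
entries do not commute. -/
theorem Hdet_comp_perm {k : ℕ} (c v : Fin k → ℤ) (τ : Equiv.Perm (Fin k)) :
    Hdet K c (fun i => v (τ i)) = ((Equiv.Perm.sign τ : ℤ) : K) • Hdet K c v := by
  unfold Hdet
  rw [smul_sum]
  conv_rhs => rw [← Equiv.sum_comp (Equiv.mulLeft τ)]
  refine sum_congr rfl fun σ _ => ?_
  have : ((Equiv.Perm.sign τ : ℤ) : K) * ((Equiv.Perm.sign τ : ℤ) : K) = 1 := by
    rw [← Int.cast_mul, Int.units_coe_mul_self, Int.cast_one]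
  rw [smul_smul]
  simp only [Equiv.coe_mulLeft, Equiv.Perm.sign_mul, Units.val_mul, Int.cast_mul,
    Equiv.Perm.mul_apply, ← mul_assoc, this, one_mul]

/-- The terms of σ and `(i j)σ` cancel. Pairing them directly avoids a division by 2. -/
theorem Hdet_eq_zero {k : ℕ} (c v : Fin k → ℤ) {i j : Fin k} (hij : i ≠ j) (h : v i = v j) :
    Hdet K c v = 0 := by
  unfold Hdet
  have hv : ∀ x, v (Equiv.swap i j x) = v x := by
    intro x
    rcases eq_or_ne x i with rfl | h1
    · rw [Equiv.swap_apply_left, h]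
    · rcases eq_or_ne x j with rfl | h2
      · rw [Equiv.swap_apply_right, h]
      · rw [Equiv.swap_apply_of_ne_of_ne h1 h2]
  refine sum_involution (fun σ _ => Equiv.swap i j * σ) ?_ ?_ (fun _ _ => mem_univ _) ?_
  · intro σ _
    simp [Equiv.Perm.sign_mul, Equiv.Perm.sign_swap hij, hv]
  · intro σ _ _ h
    exact hij (Equiv.swap_eq_one_iff.1 (mul_eq_right.1 h))
  · intro σ _
    rw [← mul_assoc, Equiv.swap_mul_self, one_mul]

/-- Reindexing `e` by σ in the σ-th term turns drops of factors into drops of columns, with the same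
number of drops; the sum over σ is then again a determinant. -/
theorem bernstein_Hdet (m : ℤ) {k : ℕ} (c v : Fin k → ℤ) :
    bernstein m (Hdet K c v) =
      ∑ e : Fin k → Fin 2, (-1 : K) ^ (∑ j, (e j : ℕ)) •
        (H K (m + (∑ j, (e j : ℕ) : ℕ)) * Hdet K c (fun j => v j - (e j : ℕ))) := by
  unfold Hdet
  rw [bernstein_sum_smul]
  simp only [bernstein_Hprod, mul_sum, smul_sum]
  rw [sum_comm (s := (univ : Finset (Fin k → Fin 2)))]
  refine sum_congr rfl fun σ _ => ?_
  rw [← (Equiv.arrowCongr σ.symm (Equiv.refl (Fin 2))).sum_comp]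
  refine sum_congr rfl fun e _ => ?_
  have hs : ∑ j, ((Equiv.arrowCongr σ.symm (Equiv.refl (Fin 2)) e) j : ℕ) = ∑ j, (e j : ℕ) :=
    Equiv.sum_comp σ (fun j => (e j : ℕ))
  rw [hs, mul_smul_comm, smul_comm]
  simp [add_sub_assoc]

/-- Laplace expansion along the first row; the minors keep the noncommuting factors of the later
rows in order. -/
theorem Hdet_succ {k : ℕ} (c v : Fin (k + 1) → ℤ) :
    Hdet K c v = ∑ p : Fin (k + 1), (-1 : K) ^ (p : ℕ) • (H K (c 0 + v p) *
      Hdet K (fun i => c i.succ) (fun i => v (p.succAbove i))) := by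
  rw [Hdet, ← Equiv.Perm.decomposeFin.symm.sum_comp, Fintype.sum_prod_type]
  refine sum_congr rfl fun p _ => ?_
  simp only [List.ofFn_succ, Hprod_cons, Equiv.Perm.decomposeFin_symm_apply_zero,
    Equiv.Perm.decomposeFin_symm_apply_succ, Equiv.Perm.decomposeFin.symm_sign]
  refine Fin.cases ?_ (fun p => ?_) p
  · simp [Hdet, mul_sum]
  -- `decomposeFin` lists the remaining columns with column 0 in the place of column `p.succ`. The
  -- cycle `p.cycleRange`, of sign `(-1)^p`, accounts for the passage to increasing order; with the
  -- sign of the transposition this makes `(-1)^(p+1)`.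
  · have h := Hdet_comp_perm (K := K) (fun i => c i.succ) (fun i => v (p.succ.succAbove i))
      p.cycleRange
    simp only [Fin.succAbove_cycleRange] at h
    have h2 : Hdet K (fun i => c i.succ) (fun i => v (p.succ.succAbove i)) = (-1 : K) ^ (p : ℕ) •
        Hdet K (fun i => c i.succ) (fun i => v (Equiv.swap 0 p.succ i.succ)) := by
      rw [h, Fin.sign_cycleRange, smul_smul]
      simp [← mul_pow]
    rw [h2, mul_smul_comm, smul_smul, Fin.val_succ, pow_succ, mul_assoc, mul_comm (-1 : K),
      ← mul_assoc, ← mul_pow, neg_one_mul, neg_neg, one_pow, one_mul]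
    simp [Hdet, mul_sum]

/-- The numbers `j + 1 - e j` increase weakly, hence strictly once they are distinct. A strictly
increasing map from `Fin k` to `Fin (k + 1)` is determined by the one value `r` it omits, and the
drops are then those at `j < r`. -/
theorem exists_eq_succAbove {k : ℕ} (e : Fin k → Fin 2)
    (h : Function.Injective fun j : Fin k => ((j : ℕ) : ℤ) + 1 - (e j : ℕ)) :
    ∃ r : Fin (k + 1), (fun j => if j.castSucc < r then 1 else 0) = e := by
  let w : Fin k → Fin (k + 1) := fun j => if e j = 1 then j.castSucc else j.succ
  have hw : ∀ j, ((w j : ℕ) : ℤ) = ((j : ℕ) : ℤ) + 1 - (e j : ℕ) := by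
    intro j
    by_cases hj : e j = 1
    · simp [w, hj]
    · have : e j = 0 := by omega
      simp [w, this]
  have hmono : StrictMono w := by
    intro i j hij
    have h1 : (w i : ℕ) ≠ w j := by
      intro h'
      have h2 : ((w i : ℕ) : ℤ) = w j := by rw [h']
      rw [hw, hw] at h2
      exact hij.ne (h h2)
    have := hw i
    have := hw j
    have := (e i).isLt
    have := (e j).isLt
    have : (i : ℕ) < j := hij
    rw [Fin.lt_def]
    omega
  obtain ⟨r, hr⟩ : ∃ r, r ∉ Set.range w := by
    by_contra! hc
    have := Fintype.card_le_of_surjective w hc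
    simp at this
  have hrange : Set.range w = Set.range r.succAbove := by
    rw [Fin.range_succAbove]
    refine Set.eq_of_subset_of_ncard_le (fun x hx => ?_) ?_ (Set.toFinite _)
    · rintro rfl
      exact hr hx
    · rw [Set.ncard_compl, Set.ncard_singleton, Set.ncard_range_of_injective hmono.injective]
      simp
  have hEq := (hmono.range_inj (Fin.strictMono_succAbove r)).1 hrange
  refine ⟨r, funext fun j => ?_⟩
  have h1 := congrArg (fun x : Fin (k + 1) => (x : ℕ)) (congrFun hEq j)
  have h2 := hw j
  have := (e j).isLt
  by_cases hj : j.castSucc < r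
  · rw [if_pos hj]
    simp only [Fin.succAbove_of_castSucc_lt _ _ hj, Fin.val_castSucc] at h1
    apply Fin.ext
    simp only [Fin.val_one]
    omega
  · rw [if_neg hj]
    simp only [Fin.succAbove_of_le_castSucc _ _ (not_lt.1 hj), Fin.val_succ] at h1
    apply Fin.ext
    simp only [Fin.val_zero]
    omega

/-- When the columns are consecutive integers, a drop pattern that is not an initial segment makes
two columns equal. The pattern `{j < r}` leaves the columns `0, …, k` without `r`. -/
theorem bernstein_Hdet_standard (m : ℤ) {k : ℕ} (c : Fin k → ℤ) :
    bernstein m (Hdet K c fun j => ((j : ℕ) : ℤ) + 1) =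
      ∑ r : Fin (k + 1), (-1 : K) ^ (r : ℕ) •
        (H K (m + (r : ℕ)) * Hdet K c (fun j => ((r.succAbove j : ℕ) : ℤ))) := by
  rw [bernstein_Hdet]
  have hcard : ∀ r : Fin (k + 1),
      ∑ j : Fin k, ((if j.castSucc < r then 1 else 0 : Fin 2) : ℕ) = r := by
    intro r
    have : ∀ j : Fin k, ((if j.castSucc < r then 1 else 0 : Fin 2) : ℕ) =
        if (j : ℕ) < r then 1 else 0 := by
      intro j
      by_cases hj : j.castSucc < r
      · have hj' : (j : ℕ) < r := hj
        rw [if_pos hj, if_pos hj', Fin.val_one]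
      · have hj' : ¬ (j : ℕ) < r := hj
        rw [if_neg hj, if_neg hj', Fin.val_zero]
    simp only [this]
    rw [Fin.sum_univ_eq_sum_range (fun j => if j < (r : ℕ) then 1 else 0) k, ← sum_filter,
      sum_const, smul_eq_mul, mul_one]
    have : (range k).filter (fun j => j < (r : ℕ)) = range r := by
      ext x
      have := r.isLt
      simp only [mem_filter, mem_range]
      omega
    rw [this, card_range]
  symm
  refine sum_of_injOn (fun r j => if j.castSucc < r then 1 else 0) ?_ (by simp) ?_ ?_
  · intro r _ s _ h
    apply Fin.ext
    rw [← hcard r, ← hcard s]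
    exact sum_congr rfl fun j _ => congrArg Fin.val (congrFun h j)
  · intro e _ he
    by_cases hinj : Function.Injective fun j : Fin k => ((j : ℕ) : ℤ) + 1 - (e j : ℕ)
    · obtain ⟨r, hr⟩ := exists_eq_succAbove e hinj
      exact absurd ⟨r, by simp, hr⟩ he
    · simp only [Function.Injective, not_forall] at hinj
      obtain ⟨i, j, h, hij⟩ := hinj
      rw [Hdet_eq_zero _ _ hij h, mul_zero, smul_zero]
  · intro r _
    rw [hcard]
    congr 3
    ext j
    by_cases hj : j.castSucc < r
    · simp [if_pos hj, Fin.succAbove_of_castSucc_lt _ _ hj]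
    · simp [if_neg hj, Fin.succAbove_of_le_castSucc _ _ (not_lt.1 hj)]

/-- The Jacobi–Trudi formula for immaculate functions. -/
theorem immaculate_eq_Hdet {k : ℕ} (μ : Fin k → ℤ) :
    immaculate K (List.ofFn μ) =
      Hdet K (fun i => μ i - ((i : ℕ) + 1)) (fun j => ((j : ℕ) : ℤ) + 1) := by
  induction k with
  | zero => simp [immaculate, Hdet, Hprod_nil]
  | succ k ih =>
    have h : immaculate K (List.ofFn μ) =
        bernstein (μ 0) (immaculate K (List.ofFn fun i => μ i.succ)) := by
      rw [List.ofFn_succ]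
      rfl
    -- Both sides are now expansions along the first row. The minors have columns smaller by 1 on
    -- the left, compensated by the row index, which is larger by 1 on the right.
    rw [h, ih, bernstein_Hdet_standard, Hdet_succ]
    refine sum_congr rfl fun r _ => ?_
    congr 2
    · congr 1
      simp
    · unfold Hdet
      refine sum_congr rfl fun σ _ => ?_
      congr 3
      ext i
      simp only [Fin.val_succ]
      push_cast
      ring

/-! ### Ribbon functions: recursion and multiplication by `H_b` -/

theorem coarser_nil_iff {β : List ℕ+} : Coarser β [] ↔ β = [] := by
  constructor
  · intro h
    exact List.length_eq_zero_iff.1 (Nat.le_zero.1 h.length_le)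
  · rintro rfl
    exact ⟨[], by simp, rfl, rfl⟩

theorem coarser_singleton_iff {a : ℕ+} {β : List ℕ+} : Coarser β [a] ↔ β = [a] := by
  constructor
  · intro h
    have h1 := h.sum_eq
    have h2 := h.length_le
    match β, h1, h2 with
    | [], h1, _ =>
      have := a.pos
      simp at h1
      omega
    | [b], h1, _ => simpa using h1
    | _ :: _ :: _, _, h2 => simp at h2
  · rintro rfl
    exact ⟨[[a]], by simp, rfl, by simp⟩

/-- Either the first block is `a` alone, or it also contains `b`, and then `a` and `b` may be merged
beforehand. -/
theorem coarser_cons_cons_iff {a b : ℕ+} {α β : List ℕ+} :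
    Coarser β (a :: b :: α) ↔
      (∃ γ, Coarser γ (b :: α) ∧ a :: γ = β) ∨ Coarser β ((a + b) :: α) := by
  constructor
  · rintro ⟨B, hB, hf, hs⟩
    match B, hB, hf, hs with
    | [], _, hf, _ => exact absurd hf (by simp)
    | [] :: B, hB, _, _ => exact absurd rfl (hB [] (by simp))
    | [x] :: B, hB, hf, hs =>
      left
      obtain ⟨rfl, hf'⟩ : x = a ∧ B.flatten = b :: α := by simpa using hf
      match β, hs with
      | [], hs => exact absurd hs (by simp)
      | y :: γ, hs =>
        simp only [List.map_cons, List.map_nil, List.sum_cons, List.sum_nil, add_zero,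
          List.cons.injEq, PNat.coe_inj] at hs
        exact ⟨γ, ⟨B, fun c hc => hB c (List.mem_cons_of_mem _ hc), hf', hs.2⟩, by rw [hs.1]⟩
    | (x :: y :: c) :: B, hB, hf, hs =>
      right
      obtain ⟨rfl, rfl, rfl⟩ : x = a ∧ y = b ∧ c ++ B.flatten = α := by simpa using hf
      refine ⟨((x + y) :: c) :: B, ?_, by simp, ?_⟩
      · intro d hd
        rcases List.mem_cons.1 hd with rfl | hd
        · simp
        · exact hB d (List.mem_cons_of_mem _ hd)
      · rw [hs]
        simp [add_assoc]
  · rintro (⟨γ, ⟨B, hB, hf, hs⟩, rfl⟩ | ⟨B, hB, hf, hs⟩)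
    · refine ⟨[a] :: B, ?_, by simp [hf], by simp [hs]⟩
      intro d hd
      rcases List.mem_cons.1 hd with rfl | hd
      · simp
      · exact hB d hd
    · match B, hB, hf, hs with
      | [], _, hf, _ => exact absurd hf (by simp)
      | [] :: B, hB, _, _ => exact absurd rfl (hB [] (by simp))
      | (x :: c) :: B, hB, hf, hs =>
        obtain ⟨rfl, rfl⟩ : x = a + b ∧ c ++ B.flatten = α := by simpa using hf
        refine ⟨(a :: b :: c) :: B, ?_, by simp, ?_⟩
        · intro d hd
          rcases List.mem_cons.1 hd with rfl | hd
          · simp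
          · exact hB d (List.mem_cons_of_mem _ hd)
        · rw [hs]
          simp [add_assoc]

/-- The two cases of `coarser_cons_cons_iff` exclude each other: in the second one the first part is
at least `a + b > a`. -/
theorem not_coarser_cons_add {a b : ℕ+} {α γ : List ℕ+} (hγ : Coarser γ (b :: α)) :
    ¬ Coarser (a :: γ) ((a + b) :: α) := by
  rintro ⟨B, hB, hf, hs⟩
  match B, hB, hf, hs with
  | [], _, hf, _ => exact absurd hf (by simp)
  | [] :: B, hB, _, _ => exact absurd rfl (hB [] (by simp))
  | (x :: c) :: B, hB, hf, hs =>
    obtain ⟨rfl, rfl⟩ : x = a + b ∧ c ++ B.flatten = α := by simpa using hf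
    simp only [List.map_cons, List.sum_cons, List.cons.injEq, PNat.add_coe] at hs
    have := b.pos
    omega

theorem ribbonComp_nil : ribbonComp K [] = 1 := by
  unfold ribbonComp
  have : {β : List ℕ+ | Coarser β []} = {[]} := by
    ext β
    exact coarser_nil_iff
  rw [this, finsum_mem_singleton]
  simp [Hcomp_nil]

theorem ribbonComp_singleton (a : ℕ+) : ribbonComp K [a] = H K ((a : ℕ) : ℤ) := by
  unfold ribbonComp
  have : {β : List ℕ+ | Coarser β [a]} = {[a]} := by
    ext β
    exact coarser_singleton_iff
  rw [this, finsum_mem_singleton]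
  simp [Hcomp]

theorem ribbonComp_cons_cons (a b : ℕ+) (α : List ℕ+) :
    ribbonComp K (a :: b :: α) =
      H K ((a : ℕ) : ℤ) * ribbonComp K (b :: α) - ribbonComp K ((a + b) :: α) := by
  unfold ribbonComp
  have hset : {β : List ℕ+ | Coarser β (a :: b :: α)} =
      (a :: ·) '' {γ : List ℕ+ | Coarser γ (b :: α)} ∪
        {β : List ℕ+ | Coarser β ((a + b) :: α)} := by
    ext β
    exact coarser_cons_cons_iff
  have hdisj : Disjoint ((a :: ·) '' {γ : List ℕ+ | Coarser γ (b :: α)})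
      {β : List ℕ+ | Coarser β ((a + b) :: α)} := by
    rw [Set.disjoint_left]
    rintro _ ⟨γ, hγ, rfl⟩
    exact not_coarser_cons_add hγ
  rw [hset, finsum_mem_union hdisj ((finite_coarser _).image _) (finite_coarser _),
    finsum_mem_image (List.cons_injective.injOn), sub_eq_add_neg]
  congr 1
  · rw [finsum_mem_eq_finite_toFinset_sum _ (finite_coarser _),
      finsum_mem_eq_finite_toFinset_sum _ (finite_coarser _), mul_sum]
    refine sum_congr rfl fun γ _ => ?_
    rw [Hcomp_cons, mul_smul_comm]
    simp
  · rw [finsum_mem_eq_finite_toFinset_sum _ (finite_coarser _),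
      finsum_mem_eq_finite_toFinset_sum _ (finite_coarser _), ← sum_neg_distrib]
    refine sum_congr rfl fun β hβ => ?_
    -- The sign exponent is a truncated subtraction, so this bound is needed to extract the factor
    -- `-1` that comes from the merged part.
    have hl : β.length ≤ α.length + 1 := by
      have hc : Coarser β ((a + b) :: α) := (Set.Finite.mem_toFinset (finite_coarser _)).1 hβ
      exact hc.length_le
    rw [List.length_cons, List.length_cons, List.length_cons, Nat.sub_add_comm hl, pow_succ,
      mul_neg_one, neg_smul]

/-- The recursion works at the left end and the product at the right end, so they do not interfere
while `γ` has two parts. With a single part `c`, the recursion merges `c` into `a` or `a + b`, which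
is why this case is separate. -/
theorem ribbonComp_concat_mul_H (γ : List ℕ+) (a b : ℕ+) :
    ribbonComp K (γ ++ [a]) * H K ((b : ℕ) : ℤ) =
      ribbonComp K (γ ++ [a, b]) + ribbonComp K (γ ++ [a + b]) := by
  match γ with
  | [] =>
    rw [List.nil_append, List.nil_append, List.nil_append, ribbonComp_cons_cons,
      ribbonComp_singleton, ribbonComp_singleton, sub_add_cancel]
  | [c] =>
    have h1 := ribbonComp_concat_mul_H [] a b
    have h2 := ribbonComp_concat_mul_H [] (c + a) b
    simp only [List.nil_append, List.cons_append] at h1 h2 ⊢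
    rw [ribbonComp_cons_cons c a [], ribbonComp_cons_cons c a [b],
      ribbonComp_cons_cons c (a + b) [], sub_mul, mul_assoc, h1, h2, mul_add, add_assoc c a b]
    abel
  | c :: d :: γ =>
    have h1 := ribbonComp_concat_mul_H (d :: γ) a b
    have h2 := ribbonComp_concat_mul_H ((c + d) :: γ) a b
    simp only [List.cons_append] at h1 h2 ⊢
    rw [ribbonComp_cons_cons, ribbonComp_cons_cons, ribbonComp_cons_cons, sub_mul, mul_assoc,
      h1, h2, mul_add]
    abel
termination_by γ.length

theorem ribbon_map (α : List ℕ+) :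
    ribbon K (α.map fun a : ℕ+ => ((a : ℕ) : ℤ)) = ribbonComp K α := by
  unfold ribbon
  have h : ∀ a ∈ α.map (fun a : ℕ+ => ((a : ℕ) : ℤ)), 0 < a := by
    intro a ha
    obtain ⟨x, -, rfl⟩ := List.mem_map.1 ha
    exact_mod_cast x.pos
  rw [dif_pos h]
  congr 1
  induction α with
  | nil => rfl
  | cons a α ih => exact congrArg (a :: ·) (ih fun x hx => h x (List.mem_cons_of_mem _ hx))

theorem ribbon_eq_zero {μ : List ℤ} (h : ∃ a ∈ μ, a ≤ 0) : ribbon K μ = 0 := by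
  obtain ⟨a, ha, h0⟩ := h
  unfold ribbon
  exact dif_neg fun h => absurd (h a ha) (not_lt.2 h0)

theorem exists_eq_map_of_pos {μ : List ℤ} (h : ∀ a ∈ μ, 0 < a) :
    ∃ α : List ℕ+, α.map (fun a : ℕ+ => ((a : ℕ) : ℤ)) = μ := by
  induction μ with
  | nil => exact ⟨[], rfl⟩
  | cons a μ ih =>
    obtain ⟨α, rfl⟩ := ih fun x hx => h x (List.mem_cons_of_mem _ hx)
    have ha : 0 < a := h a List.mem_cons_self
    obtain ⟨b, rfl⟩ : ∃ b : ℕ+, ((b : ℕ) : ℤ) = a := ⟨⟨a.toNat, by omega⟩, by simp; omega⟩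
    exact ⟨b :: α, rfl⟩

theorem ribbon_concat_mul_H (g : List ℤ) {a b : ℤ} (ha : 0 < a) (hb : 0 < b) :
    ribbon K (g ++ [a]) * H K b = ribbon K (g ++ [a, b]) + ribbon K (g ++ [a + b]) := by
  by_cases hg : ∀ x ∈ g, 0 < x
  · obtain ⟨γ, rfl⟩ := exists_eq_map_of_pos hg
    obtain ⟨a, rfl⟩ : ∃ a' : ℕ+, ((a' : ℕ) : ℤ) = a := ⟨⟨a.toNat, by omega⟩, by simp; omega⟩
    obtain ⟨b, rfl⟩ : ∃ b' : ℕ+, ((b' : ℕ) : ℤ) = b := ⟨⟨b.toNat, by omega⟩, by simp; omega⟩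
    have h := ribbonComp_concat_mul_H (K := K) γ a b
    rw [← ribbon_map, ← ribbon_map, ← ribbon_map] at h
    simpa using h
  · push Not at hg
    obtain ⟨x, hx, h0⟩ := hg
    have h : ∀ l : List ℤ, ribbon K (g ++ l) = 0 := fun l =>
      ribbon_eq_zero ⟨x, List.mem_append_left l hx, h0⟩
    rw [h, h, h, zero_mul, add_zero]

/-- The defect of `R_{(g, a)} H_b = R_{(g, a, b)}`; the last factor vanishes for `b < 0`. -/
theorem ribbon_concat_mul_H_sub (g : List ℤ) (a b : ℤ) :
    ribbon K (g ++ [a]) * H K b - ribbon K (g ++ [a, b]) =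
      if 0 < a ∧ 0 ≤ b then ribbon K (g ++ [a + b]) else 0 := by
  by_cases ha : 0 < a
  · rcases lt_trichotomy b 0 with hb | rfl | hb
    · rw [if_neg (by omega), H_of_neg hb, mul_zero, ribbon_eq_zero ⟨b, by simp, hb.le⟩, sub_zero]
    -- At `b = 0` the product is `R_{(g,a)}` while `R_{(g,a,0)} = 0`, so the defect is still
    -- `R_{(g,a+b)}`. This is why the condition is `0 ≤ b` and not `0 < b`.
    · rw [if_pos (by omega), H_zero, mul_one, ribbon_eq_zero (μ := g ++ [a, 0]) ⟨0, by simp, le_rfl⟩,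
        sub_zero, add_zero]
    · rw [if_pos (by omega), ribbon_concat_mul_H g ha hb, add_sub_cancel_left]
  · rw [if_neg (by tauto), ribbon_eq_zero ⟨a, by simp, not_lt.1 ha⟩,
      ribbon_eq_zero ⟨a, by simp, not_lt.1 ha⟩, zero_mul, sub_zero]

/-! ### Interpolation between products of complete functions and ribbons -/

variable (K) in
/-- The product of the ribbon function of the first `i` entries of `l` with the complete
homogeneous function of the remaining ones. -/
def ribbonHprod (i : ℕ) (l : List ℤ) : NSym K := ribbon K (l.take i) * Hprod K (l.drop i)

theorem ribbonHprod_sub (l : List ℤ) (i : ℕ) (h : i + 1 < l.length) :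
    ribbonHprod K (i + 1) l - ribbonHprod K (i + 2) l =
      (if 0 < l[i] ∧ 0 ≤ l[i + 1] then ribbon K (l.take i ++ [l[i] + l[i + 1]]) else 0) *
        Hprod K (l.drop (i + 2)) := by
  unfold ribbonHprod
  have h1 : l.take (i + 1) = l.take i ++ [l[i]] := by
    rw [List.take_append_getElem]
  have h2 : l.take (i + 2) = l.take i ++ [l[i], l[i + 1]] := by
    rw [← List.take_append_getElem h, h1, List.append_assoc]
    rfl
  rw [← ribbon_concat_mul_H_sub, List.drop_eq_getElem_cons h, Hprod_cons, h1, h2, ← mul_assoc,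
    sub_mul]

/-- Positivity of the first entry matters at 0, where `H_0 = 1` but `R_{(0)} = 0`. -/
theorem ribbonHprod_zero_eq_one {l : List ℤ} (h : 0 < l.length) (hl : 0 < l[0]) :
    ribbonHprod K 0 l = ribbonHprod K 1 l := by
  obtain ⟨a, l, rfl⟩ := List.exists_cons_of_length_pos h
  simp only [List.getElem_cons_zero] at hl
  obtain ⟨b, rfl⟩ : ∃ b : ℕ+, ((b : ℕ) : ℤ) = a := ⟨⟨a.toNat, by omega⟩, by simp; omega⟩
  have h0 := ribbon_map (K := K) []
  have h1 := ribbon_map (K := K) [b]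
  rw [ribbonComp_nil] at h0
  rw [ribbonComp_singleton] at h1
  simp only [List.map_nil, List.map_cons] at h0 h1
  simp [ribbonHprod, h0, h1, Hprod_cons]

theorem ribbonHprod_length (l : List ℤ) : ribbonHprod K l.length l = ribbon K l := by
  simp [ribbonHprod, Hprod_nil]

theorem ribbonHprod_zero (l : List ℤ) : ribbonHprod K 0 l = Hprod K l := by
  have h0 := ribbon_map (K := K) []
  rw [ribbonComp_nil] at h0
  simp only [List.map_nil] at h0
  simp [ribbonHprod, h0]

/-- The sequence `(m - 1 + σ_1, m - 2 + σ_2, …)`. -/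
def shiftedRectangle (m : ℕ) {k : ℕ} (σ : Equiv.Perm (Fin k)) : List ℤ :=
  List.ofFn fun i : Fin k => (m : ℤ) - (((i : ℕ) : ℤ) + 1) + (((σ i : Fin k) : ℕ) + 1 : ℤ)

theorem length_shiftedRectangle (m : ℕ) {k : ℕ} (σ : Equiv.Perm (Fin k)) :
    (shiftedRectangle m σ).length = k := List.length_ofFn

theorem getElem_shiftedRectangle (m : ℕ) {k : ℕ} (σ : Equiv.Perm (Fin k)) (i : ℕ)
    (h : i < (shiftedRectangle m σ).length) :
    (shiftedRectangle m σ)[i] =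
      (m : ℤ) - i + (σ ⟨i, by rwa [length_shiftedRectangle] at h⟩ : ℕ) := by
  simp only [shiftedRectangle, List.getElem_ofFn]
  ring

/-- The change from `i + 1` to `i + 2` is the defect at two adjacent entries. Exchanging the values
of σ at these two positions preserves the defect and reverses the sign, so the total change is zero.
-/
theorem sum_sign_ribbonHprod_succ (m : ℕ) {k : ℕ} (i : ℕ) (h : i + 1 < k) :
    ∑ σ : Equiv.Perm (Fin k), ((Equiv.Perm.sign σ : ℤ) : K) •
        ribbonHprod K (i + 1) (shiftedRectangle m σ) =
      ∑ σ : Equiv.Perm (Fin k), ((Equiv.Perm.sign σ : ℤ) : K) •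
        ribbonHprod K (i + 2) (shiftedRectangle m σ) := by
  rw [← sub_eq_zero, ← sum_sub_distrib]
  simp only [← smul_sub]
  have hne : (⟨i, by omega⟩ : Fin k) ≠ ⟨i + 1, h⟩ := by simp
  set s : Equiv.Perm (Fin k) := Equiv.swap ⟨i, by omega⟩ ⟨i + 1, h⟩ with hs
  refine sum_involution (fun σ _ => σ * s) ?_ ?_ (fun _ _ => mem_univ _) ?_
  · intro σ _
    have hget : ∀ (j : ℕ) (hj : j < k), j ≠ i → j ≠ i + 1 →
        (σ * s) ⟨j, hj⟩ = σ ⟨j, hj⟩ := by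
      intro j hj h1 h2
      rw [Equiv.Perm.mul_apply, hs, Equiv.swap_apply_of_ne_of_ne] <;> simpa
    have htake : (shiftedRectangle m (σ * s)).take i = (shiftedRectangle m σ).take i := by
      refine List.ext_getElem (by simp [length_shiftedRectangle]) fun j h1 h2 => ?_
      rw [List.length_take] at h1
      rw [List.getElem_take, List.getElem_take, getElem_shiftedRectangle,
        getElem_shiftedRectangle, hget j _ (by omega) (by omega)]
    have hdrop : (shiftedRectangle m (σ * s)).drop (i + 2) =
        (shiftedRectangle m σ).drop (i + 2) := by
      refine List.ext_getElem (by simp [length_shiftedRectangle]) fun j h1 h2 => ?_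
      rw [List.getElem_drop, List.getElem_drop, getElem_shiftedRectangle,
        getElem_shiftedRectangle, hget _ _ (by omega) (by omega)]
    rw [ribbonHprod_sub _ _ (by rwa [length_shiftedRectangle]),
      ribbonHprod_sub _ _ (by rwa [length_shiftedRectangle]), htake, hdrop]
    simp only [getElem_shiftedRectangle, Equiv.Perm.mul_apply, hs, Equiv.swap_apply_left,
      Equiv.swap_apply_right, Equiv.Perm.sign_mul, Equiv.Perm.sign_swap hne]
    generalize ((σ ⟨i, by omega⟩ : Fin k) : ℕ) = x
    generalize ((σ ⟨i + 1, h⟩ : Fin k) : ℕ) = y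
    have hsum : (m : ℤ) - (i : ℕ) + y + (m - (i + 1 : ℕ) + x) =
        m - (i : ℕ) + x + (m - (i + 1 : ℕ) + y) := by ring
    -- The two conjuncts trade places: `0 < m - i + x` is the same as `0 ≤ m - (i + 1) + x`, and
    -- likewise for `y`. This uses that the two rows have the same length `m`.
    have hiff : (0 < (m : ℤ) - (i : ℕ) + y ∧ 0 ≤ (m : ℤ) - (i + 1 : ℕ) + x) ↔
        (0 < (m : ℤ) - (i : ℕ) + x ∧ 0 ≤ (m : ℤ) - (i + 1 : ℕ) + y) := by
      push_cast
      omega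
    simp only [hsum, hiff, mul_neg_one, Units.val_neg, Int.cast_neg, neg_smul, add_neg_cancel]
  · intro σ _ _ h'
    exact hne (Equiv.swap_eq_one_iff.1 (mul_eq_left.1 h'))
  · intro σ _
    rw [mul_assoc, hs, Equiv.swap_mul_self, mul_one]

theorem sum_sign_ribbonHprod (m k : ℕ) (hm : 1 ≤ m) (i : ℕ) (hi : i ≤ k) :
    ∑ σ : Equiv.Perm (Fin k), ((Equiv.Perm.sign σ : ℤ) : K) •
        ribbonHprod K i (shiftedRectangle m σ) =
      ∑ σ : Equiv.Perm (Fin k), ((Equiv.Perm.sign σ : ℤ) : K) •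
        Hprod K (shiftedRectangle m σ) := by
  induction i with
  | zero => simp only [ribbonHprod_zero]
  | succ i ih =>
    rw [← ih (by omega)]
    cases i with
    | zero =>
      -- The first step holds term by term: the first entry is `m + σ 0` with `σ 0` counted from 0,
      -- which is positive because `m ≥ 1`.
      refine sum_congr rfl fun σ _ => ?_
      rw [ribbonHprod_zero_eq_one (by rw [length_shiftedRectangle]; omega)]
      rw [getElem_shiftedRectangle]
      push_cast
      omega
    | succ i => exact (sum_sign_ribbonHprod_succ m i (by omega)).symm

end NCSym

end

theorem theorem6p3 (K : Type*) [Field K] [CharZero K] (m k : ℕ) (hm : 1 ≤ m) :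
    NCSym.immaculate K (List.replicate k (m : ℤ)) =
      ∑ σ : Equiv.Perm (Fin k), ((Equiv.Perm.sign σ : ℤ) : K) •
        NCSym.ribbon K (List.ofFn fun i : Fin k =>
          (m : ℤ) - (((i : ℕ) : ℤ) + 1) + (((σ i : Fin k) : ℕ) + 1 : ℤ)) := by
  have h := NCSym.sum_sign_ribbonHprod (K := K) m k hm k le_rfl
  have hl : ∀ σ : Equiv.Perm (Fin k), NCSym.ribbonHprod K k (NCSym.shiftedRectangle m σ) =
      NCSym.ribbon K (NCSym.shiftedRectangle m σ) := by
    intro σ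
    have := NCSym.ribbonHprod_length (K := K) (NCSym.shiftedRectangle m σ)
    rwa [NCSym.length_shiftedRectangle] at this
  simp only [hl] at h
  rw [← List.ofFn_const, NCSym.immaculate_eq_Hdet]
  -- The entries of `shiftedRectangle m σ` are the indices `c i + v (σ i)` of the Jacobi–Trudi
  -- determinant, so the sum of products of `H` unfolds to `Hdet`.
  exact h.symm
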